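/- Conventions. The elements $0$ and $1$ of a Boolean algebra need not be distinct; complement is written ${}^*$. A *contact relation* on a Boolean algebra $B$ is a binary relation $\rho$ on $B$ such that for all $a,b,c\in B$: $a\neq 0$ implies $a\rho a$; $a\rho b$ implies $a\ne 0$ and $b\neq 0$; $a\rho b$ implies $b\rho a$; and $a\rho(b\vee c)$ iff $a\rho b$ or $a\rho c$. Write $a\ll_\rho b$ if $a\rho b^*$ does not hold. A *complete local contact algebra* is a triple $(B,\rho,\mathbb B)$ where $B$ is a complete Boolean algebra, $\rho$ is a contact relation on $B$, and $\mathbb B$ is an ideal (possibly non-proper) of $B$ such that - (BC1) if $a\in\mathbb B$, $c\in B$ and $a\ll_\rho c$, then $a\ll_\rho b\ll_\rho c$ for some $b\in\mathbb B$; - (BC2) if $a\rho b$, then $a\rho(c\wedge b)$ for some $c\in\mathbb B$; - (BC3) if $a\neq 0$, then $b\ll_\rho a$ for some $b\in\mathbb B\setminus\{0\}$. Let $\mathbf{EOpPerLC}$ be the category whose objects are all complete local contact algebras and whose morphisms $\psi:(A,\rho,\mathbb B)\to(B,\eta,\mathbb B')$ are all functions $\psi:A\to B$ satisfying the following conditions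 (with the usual composition of functions): - (EF1) for every $a\in A$, $\psi(a)=0$ iff $a=0$; - (EF2) $\psi$ preserves all joins; - (EF3) if $a\in A$, $b\in B$ and $b\le\psi(a)$, then there is $c\in A$ with $c\le a$ and $\psi(c)=b$; - (EL4) for all $a,b\in A$, $a\rho b$ implies $\psi(a)\eta\psi(b)$; - (EL5) if $a\in\mathbb B$, then $\psi(a)\in\mathbb B'$; - (EL6) if $b\in\mathbb B'$, then $\psi_P(b)\in\mathbb B$; - (EL7) if $b\in B$, $a\in\mathbb B$ and $\psi(a)\eta b$, then $a\rho\psi_P(b)$, where $\psi_P:B\to A$ is the right adjoint of $\psi$, i.e. $\psi_P(b)=\bigvee\{a\in A\mid\psi(a)\le b\}$. Let $\mathbf{OpPerLC}$ be the category of all locally compact Hausdorff spaces and all open perfect maps between them, where open maps and closed maps are assumed continuous but not onto, and a map is *perfect* if it is closed and all its point inverses are compact. **Theorem.** The categories $\mathbf{OpPerLC}$ and $\mathbf{EOpPerLC}$ are equivalent. -/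

import Mathlib

open CategoryTheory

universe u

namespace LocalContact

/-! ### Locally compact Hausdorff spaces and open perfect maps -/

/-- A perfect map: continuous, closed, with compact point inverses (not necessarily onto). -/
structure IsPerfectMap {X Y : Type*} [TopologicalSpace X] [TopologicalSpace Y]
    (f : X → Y) : Prop where
  continuous : Continuous f
  isClosedMap : IsClosedMap f
  isCompact_fiber : ∀ y : Y, IsCompact (f ⁻¹' {y})

theorem IsPerfectMap.id (X : Type*) [TopologicalSpace X] :
    IsPerfectMap (fun x : X => x) where
  continuous := continuous_id
  isClosedMap := IsClosedMap.id
  isCompact_fiber _ := isCompact_singleton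

theorem IsPerfectMap.comp {X Y Z : Type*} [TopologicalSpace X] [TopologicalSpace Y]
    [TopologicalSpace Z] {g : Y → Z} {f : X → Y} (hg : IsPerfectMap g) (hf : IsPerfectMap f) :
    IsPerfectMap (fun x => g (f x)) := by
  have hf' : IsProperMap f := isProperMap_iff_isClosedMap_and_compact_fibers.2
    ⟨hf.continuous, hf.isClosedMap, fun y => hf.isCompact_fiber y⟩
  exact ⟨hg.continuous.comp hf.continuous, hg.isClosedMap.comp hf.isClosedMap,
    fun z => hf'.isCompact_preimage (hg.isCompact_fiber z)⟩

/-- Objects of `OpPerLC`: locally compact Hausdorff spaces. -/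
structure OpPerLC : Type (u + 1) where
  carrier : Type u
  [top : TopologicalSpace carrier]
  [locallyCompact : LocallyCompactSpace carrier]
  [t2 : T2Space carrier]

attribute [instance] OpPerLC.top OpPerLC.locallyCompact OpPerLC.t2

/-- Morphisms of `OpPerLC`: open perfect maps. -/
@[ext]
structure OpPerLC.Hom (X Y : OpPerLC.{u}) : Type u where
  toFun : X.carrier → Y.carrier
  isPerfectMap : IsPerfectMap toFun
  isOpenMap : IsOpenMap toFun

/-- The category of locally compact Hausdorff spaces and open perfect maps. -/
instance : Category OpPerLC.{u} where
  Hom X Y := OpPerLC.Hom X Y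
  id X := ⟨fun x => x, IsPerfectMap.id X.carrier, IsOpenMap.id⟩
  comp f g := ⟨fun x => g.toFun (f.toFun x), g.isPerfectMap.comp f.isPerfectMap,
    g.isOpenMap.comp f.isOpenMap⟩

/-! ### Local contact algebras -/

/-- `C` is a contact relation on the Boolean algebra `B`, i.e. `(B, C)` is a contact algebra. -/
structure IsContactRelation {B : Type*} [BooleanAlgebra B] (C : B → B → Prop) : Prop where
  c1 : ∀ a, a ≠ ⊥ → C a a
  c2 : ∀ a b, C a b → a ≠ ⊥ ∧ b ≠ ⊥
  c3 : ∀ a b, C a b → C b a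
  c4 : ∀ a b c, C a (b ⊔ c) ↔ C a b ∨ C a c

/-- Non-tangential inclusion `a ≪ b` associated with a contact relation. -/
def NonTangential {B : Type*} [BooleanAlgebra B] (C : B → B → Prop) (a b : B) : Prop :=
  ¬ C a bᶜ

/-- `(B, ρ, I)` is a local contact algebra; `I` is the (possibly improper) ideal of
bounded elements. -/
structure IsLocalContactAlgebra {B : Type*} [BooleanAlgebra B] (ρ : B → B → Prop)
    (I : Order.Ideal B) : Prop extends IsContactRelation ρ where
  bc1 : ∀ a ∈ I, ∀ c, NonTangential ρ a c →
    ∃ b ∈ I, NonTangential ρ a b ∧ NonTangential ρ b c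
  bc2 : ∀ a b, ρ a b → ∃ c ∈ I, ρ a (c ⊓ b)
  bc3 : ∀ a, a ≠ ⊥ → ∃ b ∈ I, b ≠ ⊥ ∧ NonTangential ρ b a

section Morphisms

variable {A B D : Type*} [CompleteBooleanAlgebra A] [CompleteBooleanAlgebra B]
  [CompleteBooleanAlgebra D]

/-- The right adjoint `ψ_P` of a join-preserving map `ψ`, see `gc_rightAdjoint`. -/
def rightAdjoint (ψ : A → B) (b : B) : A := sSup {a | ψ a ≤ b}

theorem gc_rightAdjoint {ψ : A → B} (h : ∀ s : Set A, ψ (sSup s) = sSup (ψ '' s)) :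
    GaloisConnection ψ (rightAdjoint ψ) := by
  have hmono : Monotone ψ := by
    intro a b hab
    have h2 := h {a, b}
    rw [sSup_pair, Set.image_pair, sSup_pair, sup_eq_right.2 hab] at h2
    exact sup_eq_right.1 h2.symm
  intro a b
  constructor
  · intro hab
    exact le_sSup hab
  · intro hab
    refine (hmono hab).trans ?_
    rw [rightAdjoint, h]
    apply sSup_le
    rintro _ ⟨c, hc, rfl⟩
    exact hc

/-- `ESkeLC`-morphisms `(A, ρ, I) → (B, η, J)`. -/
structure IsESkeLCHom (ρ : A → A → Prop) (I : Order.Ideal A) (η : B → B → Prop)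
    (J : Order.Ideal B) (ψ : A → B) : Prop where
  ef1 : ∀ a, ψ a = ⊥ ↔ a = ⊥
  ef2 : ∀ s : Set A, ψ (sSup s) = sSup (ψ '' s)
  ef3 : ∀ a b, b ≤ ψ a → ∃ c, c ≤ a ∧ ψ c = b
  el4 : ∀ a b, ρ a b → η (ψ a) (ψ b)
  el5 : ∀ a ∈ I, ψ a ∈ J

/-- `ESkePerLC`-morphisms `(A, ρ, I) → (B, η, J)`. -/
structure IsESkePerLCHom (ρ : A → A → Prop) (I : Order.Ideal A) (η : B → B → Prop)
    (J : Order.Ideal B) (ψ : A → B) : Prop extends IsESkeLCHom ρ I η J ψ where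
  el6 : ∀ b ∈ J, rightAdjoint ψ b ∈ I

/-- `EOpPerLC`-morphisms `(A, ρ, I) → (B, η, J)`. -/
structure IsEOpPerLCHom (ρ : A → A → Prop) (I : Order.Ideal A) (η : B → B → Prop)
    (J : Order.Ideal B) (ψ : A → B) : Prop extends IsESkePerLCHom ρ I η J ψ where
  el7 : ∀ b, ∀ a ∈ I, η (ψ a) b → ρ a (rightAdjoint ψ b)

theorem rightAdjoint_id (a : A) : rightAdjoint (fun x : A => x) a = a :=
  le_antisymm (sSup_le fun _ h => h) (le_sSup (le_refl a))

theorem rightAdjoint_comp {ψ : A → B} {χ : B → D}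
    (hχ : ∀ s : Set B, χ (sSup s) = sSup (χ '' s))
    (d : D) : rightAdjoint (fun a => χ (ψ a)) d = rightAdjoint ψ (rightAdjoint χ d) := by
  have h : {a | χ (ψ a) ≤ d} = {a | ψ a ≤ rightAdjoint χ d} := by
    ext a
    exact gc_rightAdjoint hχ (ψ a) d
  simp only [rightAdjoint] at h ⊢
  rw [h]

theorem IsEOpPerLCHom.id (ρ : A → A → Prop) (I : Order.Ideal A) :
    IsEOpPerLCHom ρ I ρ I (fun a : A => a) where
  ef1 _ := Iff.rfl
  ef2 s := by simp
  ef3 a b h := ⟨b, h, rfl⟩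
  el4 _ _ h := h
  el5 _ h := h
  el6 b h := by rwa [rightAdjoint_id]
  el7 b a _ h := by rwa [rightAdjoint_id]

theorem IsEOpPerLCHom.comp {ρ : A → A → Prop} {I : Order.Ideal A} {η : B → B → Prop}
    {J : Order.Ideal B} {θ : D → D → Prop} {K : Order.Ideal D} {ψ : A → B} {χ : B → D}
    (hχ : IsEOpPerLCHom η J θ K χ) (hψ : IsEOpPerLCHom ρ I η J ψ) :
    IsEOpPerLCHom ρ I θ K (fun a => χ (ψ a)) where
  ef1 a := (hχ.ef1 _).trans (hψ.ef1 a)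
  ef2 s := by rw [hψ.ef2, hχ.ef2, Set.image_image]
  ef3 a d h := by
    obtain ⟨b, hb, rfl⟩ := hχ.ef3 _ _ h
    obtain ⟨c, hc, rfl⟩ := hψ.ef3 _ _ hb
    exact ⟨c, hc, rfl⟩
  el4 a b h := hχ.el4 _ _ (hψ.el4 _ _ h)
  el5 a h := hχ.el5 _ (hψ.el5 _ h)
  el6 d h := by
    rw [rightAdjoint_comp hχ.ef2]
    exact hψ.el6 _ (hχ.el6 _ h)
  el7 d a ha h := by
    rw [rightAdjoint_comp hχ.ef2]
    exact hψ.el7 _ _ ha (hχ.el7 _ _ (hψ.el5 _ ha) h)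

end Morphisms

/-- Objects of `EOpPerLC`: complete local contact algebras. -/
structure EOpPerLC : Type (u + 1) where
  carrier : Type u
  [alg : CompleteBooleanAlgebra carrier]
  rel : carrier → carrier → Prop
  bdd : Order.Ideal carrier
  isLocalContactAlgebra : IsLocalContactAlgebra rel bdd

attribute [instance] EOpPerLC.alg

/-- Morphisms of `EOpPerLC`: the `ESkePerLC`-morphisms satisfying (EL7). -/
@[ext]
structure EOpPerLC.Hom (A B : EOpPerLC.{u}) : Type u where
  toFun : A.carrier → B.carrier
  isHom : IsEOpPerLCHom A.rel A.bdd B.rel B.bdd toFun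

/-- The category `EOpPerLC`, with the usual composition of functions. -/
instance : Category EOpPerLC.{u} where
  Hom A B := EOpPerLC.Hom A B
  id A := ⟨fun a => a, IsEOpPerLCHom.id A.rel A.bdd⟩
  comp f g := ⟨fun a => g.toFun (f.toFun a), g.isHom.comp f.isHom⟩

end LocalContact

/-! A locally compact Hausdorff space is encoded by its regular open sets, where contact means that
closures meet and boundedness means compact closure. An open perfect map `f` acts by `U ↦ reg (f ''
pts U)`, whose right adjoint is preimage (`gc_reg_image`). This functor is shown to be faithful,
full and essentially surjective.

Points are recovered as prime round filters. In an abstract algebra, prime ideals supply enough of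
them to detect contact (`exists_of_rel`), and ultrafilter limits make bounded elements relatively
compact. Completeness then makes every regular open set basic, so the algebra is the regular open
algebra of its points (`RoundPoint.orderIso`). In a space, every such filter comes from a point
(`exists_forall_mem_iff`).

For fullness, (EF1)-(EF3) make the right adjoint of a morphism commute with complements. Pulling
filters back along it defines a map of points: (EL4) keeps primeness, (EL5) keeps a bounded member
and (EL7) keeps roundness. (EL6) makes the resulting map perfect, and disjointness across the
adjunction makes it open (`exists_map_of_isEOpPerLCHom`). -/

namespace LocalContact

/-! ### Contact relations and non-tangential inclusion -/

section ContactRelation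

variable {B : Type*} [BooleanAlgebra B] {ρ : B → B → Prop}

theorem IsContactRelation.mono (h : IsContactRelation ρ) {a b a' b' : B} (hab : ρ a b)
    (ha : a ≤ a') (hb : b ≤ b') : ρ a' b' := by
  have right : ∀ {a b b' : B}, ρ a b → b ≤ b' → ρ a b' := by
    intro a b b' hab hb
    rw [← sup_eq_right.2 hb]
    exact (h.c4 _ _ _).2 (Or.inl hab)
  exact h.c3 _ _ (right (h.c3 _ _ (right hab hb)) ha)

theorem IsContactRelation.of_inf_ne_bot (h : IsContactRelation ρ) {a b : B} (hab : a ⊓ b ≠ ⊥) :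
    ρ a b :=
  h.mono (h.c1 _ hab) inf_le_left inf_le_right

namespace NonTangential

theorem le (h : IsContactRelation ρ) {a b : B} (hab : NonTangential ρ a b) : a ≤ b := by
  by_contra hle
  refine hab (h.of_inf_ne_bot fun h0 => hle ?_)
  simpa using le_compl_iff_disjoint_right.2 (disjoint_iff.2 h0)

theorem mono (h : IsContactRelation ρ) {a b a' b' : B} (hab : NonTangential ρ a b)
    (ha : a' ≤ a) (hb : b ≤ b') : NonTangential ρ a' b' :=
  fun hρ => hab (h.mono hρ ha (compl_le_compl hb))

theorem compl (h : IsContactRelation ρ) {a b : B} (hab : NonTangential ρ a b) :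
    NonTangential ρ bᶜ aᶜ := fun hρ => hab (by
  rw [compl_compl] at hρ
  exact h.c3 _ _ hρ)

theorem inf (h : IsContactRelation ρ) {a b c : B} (hb : NonTangential ρ a b)
    (hc : NonTangential ρ a c) : NonTangential ρ a (b ⊓ c) := by
  intro hρ
  rw [compl_inf, h.c4] at hρ
  exact hρ.elim hb hc

theorem top (h : IsContactRelation ρ) (a : B) : NonTangential ρ a ⊤ := fun hρ =>
  (h.c2 _ _ hρ).2 compl_top

end NonTangential

end ContactRelation

/-! ### The space of round points -/

/-- A point of a local contact algebra: a round filter with a bounded element that is prime with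
respect to non-tangential inclusion. -/
@[ext]
structure RoundPoint {B : Type*} [BooleanAlgebra B] (ρ : B → B → Prop) (I : Order.Ideal B) where
  carrier : Set B
  mem_of_le : ∀ {a b}, a ∈ carrier → a ≤ b → b ∈ carrier
  inf_mem : ∀ {a b}, a ∈ carrier → b ∈ carrier → a ⊓ b ∈ carrier
  bot_notMem : ⊥ ∉ carrier
  exists_bdd : ∃ a ∈ carrier, a ∈ I
  round : ∀ b ∈ carrier, ∃ a ∈ carrier, NonTangential ρ a b
  prime : ∀ a b, NonTangential ρ a b → aᶜ ∈ carrier ∨ b ∈ carrier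

namespace RoundPoint

section

variable {B : Type*} [BooleanAlgebra B] {ρ : B → B → Prop} {I : Order.Ideal B}

instance : Membership B (RoundPoint ρ I) := ⟨fun F a => a ∈ F.carrier⟩

theorem compl_notMem (F : RoundPoint ρ I) {a : B} (ha : a ∈ F) : aᶜ ∉ F := fun h =>
  F.bot_notMem (by simpa using F.inf_mem ha h)

theorem inf_mem_iff (F : RoundPoint ρ I) {a b : B} : a ⊓ b ∈ F ↔ a ∈ F ∧ b ∈ F :=
  ⟨fun h => ⟨F.mem_of_le h inf_le_left, F.mem_of_le h inf_le_right⟩, fun h => F.inf_mem h.1 h.2⟩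

theorem exists_bdd_nonTangential (h : IsLocalContactAlgebra ρ I) (F : RoundPoint ρ I) {b : B}
    (hb : b ∈ F) : ∃ a ∈ F, a ∈ I ∧ NonTangential ρ a b := by
  obtain ⟨a, ha, hab⟩ := F.round b hb
  obtain ⟨c, hc, hcI⟩ := F.exists_bdd
  exact ⟨a ⊓ c, F.inf_mem ha hc, I.lower inf_le_right hcI, hab.mono h.1 inf_le_left le_rfl⟩

/-- The set of points whose filter contains `a`. -/
def basicOpen (ρ : B → B → Prop) (I : Order.Ideal B) (a : B) : Set (RoundPoint ρ I) :=
  {F | a ∈ F}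

/-- The point determined by a prime ideal that misses some bounded element. -/
def ofPrime (h : IsLocalContactAlgebra ρ I) (M : Order.Ideal B) (hM : M.IsPrime)
    (hMI : ∃ c ∈ I, c ∉ M) : RoundPoint ρ I :=
  have inf_notMem : ∀ {a b : B}, a ∉ M → b ∉ M → a ⊓ b ∉ M := fun ha hb hab =>
    (hM.mem_or_mem hab).elim ha hb
  { carrier := {b | ∃ a ∉ M, NonTangential ρ a b}
    mem_of_le := by
      rintro a b ⟨c, hc, hca⟩ hab
      exact ⟨c, hc, hca.mono h.1 le_rfl hab⟩
    inf_mem := by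
      rintro a b ⟨c, hc, hca⟩ ⟨d, hd, hdb⟩
      exact ⟨c ⊓ d, inf_notMem hc hd,
        (hca.mono h.1 inf_le_left le_rfl).inf h.1 (hdb.mono h.1 inf_le_right le_rfl)⟩
    bot_notMem := by
      rintro ⟨c, hc, hc0⟩
      exact hc (M.lower (hc0.le h.1) M.bot_mem)
    exists_bdd := by
      obtain ⟨c, hcI, hc⟩ := hMI
      obtain ⟨d, hdI, hcd, -⟩ := h.bc1 c hcI ⊤ (.top h.1 c)
      exact ⟨d, ⟨c, hc, hcd⟩, hdI⟩
    round := by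
      rintro b ⟨a, ha, hab⟩
      obtain ⟨c, hcI, hc⟩ := hMI
      obtain ⟨d, -, had, hdb⟩ := h.bc1 (a ⊓ c) (I.lower inf_le_right hcI) b
        (hab.mono h.1 inf_le_left le_rfl)
      exact ⟨d, ⟨a ⊓ c, inf_notMem ha hc, had⟩, hdb⟩
    prime := by
      intro a b hab
      obtain ⟨c, hcI, hc⟩ := hMI
      -- (BC1) interpolates only above bounded elements, so `a` is cut down to `a ⊓ c'`. If the
      -- interpolant `d` lies in `M`, then `dᶜ ⊓ c` witnesses `aᶜ`: the condition `c ≪ c'` cancels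
      -- the truncation.
      obtain ⟨c', hcI', hcc', -⟩ := h.bc1 c hcI ⊤ (.top h.1 c)
      obtain ⟨d, -, had, hdb⟩ := h.bc1 (a ⊓ c') (I.lower inf_le_right hcI') b
        (hab.mono h.1 inf_le_left le_rfl)
      by_cases hd : d ∈ M
      · left
        have hd' : dᶜ ∉ M := fun hd' => hM.toIsProper.top_notMem
          (by simpa using M.sup_mem hd hd')
        have hle : dᶜ ⊓ c ≤ dᶜ := inf_le_left
        refine ⟨dᶜ ⊓ c, inf_notMem hd' hc, ?_⟩
        have h1 : NonTangential ρ (dᶜ ⊓ c) ((a ⊓ c')ᶜ ⊓ c') :=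
          ((had.compl h.1).mono h.1 inf_le_left le_rfl).inf h.1
            (hcc'.mono h.1 inf_le_right le_rfl)
        refine h1.mono h.1 le_rfl ?_
        rw [compl_inf, inf_sup_right, compl_inf_eq_bot, sup_bot_eq]
        exact inf_le_left
      · exact Or.inr ⟨d, hd, hdb⟩ }

end

end RoundPoint

theorem exists_isPrime_notMem {B : Type*} [BooleanAlgebra B] (J : Order.Ideal B) {a : B}
    (ha : a ∉ J) : ∃ M : Order.Ideal B, M.IsPrime ∧ J ≤ M ∧ a ∉ M := by
  obtain ⟨M, hM, hJM, hdis⟩ := DistribLattice.prime_ideal_of_disjoint_filter_ideal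
    (F := Order.PFilter.principal a) (I := J) (by
      rw [Set.disjoint_left]
      exact fun b hb hbJ => ha (J.lower hb hbJ))
  exact ⟨M, hM, hJM, Set.disjoint_left.1 hdis (Order.PFilter.mem_principal.2 le_rfl)⟩

namespace RoundPoint

section

variable {B : Type*} [BooleanAlgebra B] {ρ : B → B → Prop} {I : Order.Ideal B}

/-- Elements in contact share a point of their closures. -/
theorem exists_of_rel (h : IsLocalContactAlgebra ρ I) {a b : B} (hab : ρ a b) :
    ∃ F : RoundPoint ρ I, aᶜ ∉ F ∧ bᶜ ∉ F := by
  obtain ⟨c, hcI, hc⟩ := h.bc2 a b hab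
  -- A prime ideal containing everything out of contact with `a` keeps `aᶜ` out of its round filter.
  -- Missing `c ⊓ b` excludes `bᶜ` and also supplies the bounded element outside the ideal.
  let J : Order.Ideal B := Order.IsIdeal.toIdeal (I := {d | ¬ ρ a d})
    { IsLowerSet := fun d e hle hd he => hd (h.mono he le_rfl hle)
      Nonempty := ⟨⊥, fun h0 => (h.c2 _ _ h0).2 rfl⟩
      Directed := fun d hd e he => ⟨d ⊔ e, fun hde => ((h.c4 _ _ _).1 hde).elim hd he,
        le_sup_left, le_sup_right⟩ }
  have hJ : ∀ d, d ∈ J ↔ ¬ ρ a d := fun d => Iff.rfl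
  obtain ⟨M, hM, hJM, hcM⟩ := exists_isPrime_notMem J (a := c ⊓ b) (by rw [hJ]; exact not_not.2 hc)
  have hbM : b ∉ M := fun hb => hcM (M.lower inf_le_right hb)
  refine ⟨ofPrime h M hM ⟨c ⊓ b, I.lower inf_le_left hcI, hcM⟩, ?_, ?_⟩
  · rintro ⟨d, hd, hda⟩
    refine hd (hJM ((hJ d).2 fun had => hda ?_))
    rw [compl_compl]
    exact h.c3 _ _ had
  · rintro ⟨d, hd, hdb⟩
    rcases hM.mem_or_mem (x := d) (y := b) (by
      rw [(le_compl_iff_disjoint_right.1 (hdb.le h.1)).eq_bot]; exact M.bot_mem) with h1 | h1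
    · exact hd h1
    · exact hbM h1

theorem rel_of_compl_notMem (F : RoundPoint ρ I) {a b : B} (ha : aᶜ ∉ F) (hb : bᶜ ∉ F) :
    ρ a b := by
  by_contra hab
  exact (F.prime a bᶜ (by rwa [NonTangential, compl_compl])).elim ha hb

/-- (BC3) provides a nonzero `b ≪ a`; a point in the closure of `b` then contains `a` by primeness.
-/
theorem exists_mem (h : IsLocalContactAlgebra ρ I) {a : B} (ha : a ≠ ⊥) :
    ∃ F : RoundPoint ρ I, a ∈ F := by
  obtain ⟨b, -, hb0, hba⟩ := h.bc3 a ha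
  obtain ⟨F, hF, -⟩ := exists_of_rel h (h.c1 b hb0)
  exact ⟨F, (F.prime b a hba).resolve_left hF⟩

theorem basicOpen_subset_iff (h : IsLocalContactAlgebra ρ I) {a b : B} :
    basicOpen ρ I a ⊆ basicOpen ρ I b ↔ a ≤ b := by
  refine ⟨fun hab => ?_, fun hab F hF => F.mem_of_le hF hab⟩
  by_contra hle
  obtain ⟨F, hF⟩ := exists_mem h (a := a ⊓ bᶜ) (fun h0 => hle (by
    simpa using le_compl_iff_disjoint_right.2 (disjoint_iff.2 h0)))
  exact F.compl_notMem (hab (F.inf_mem_iff.1 hF).1) (F.inf_mem_iff.1 hF).2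

instance : TopologicalSpace (RoundPoint ρ I) :=
  TopologicalSpace.generateFrom (Set.range (basicOpen ρ I))

theorem isTopologicalBasis :
    TopologicalSpace.IsTopologicalBasis (Set.range (basicOpen ρ I)) where
  exists_subset_inter := by
    rintro _ ⟨a, rfl⟩ _ ⟨b, rfl⟩ F ⟨ha, hb⟩
    exact ⟨_, ⟨a ⊓ b, rfl⟩, F.inf_mem ha hb, fun G hG => G.inf_mem_iff.1 hG⟩
  sUnion_eq := by
    rw [Set.eq_univ_iff_forall]
    intro F
    obtain ⟨a, ha, -⟩ := F.exists_bdd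
    exact ⟨_, ⟨a, rfl⟩, ha⟩
  eq_generateFrom := rfl

theorem isOpen_basicOpen (a : B) : IsOpen (basicOpen ρ I a) :=
  isTopologicalBasis.isOpen ⟨a, rfl⟩

/-- A basic neighbourhood given by `b` that misses `a` has `b ⊓ a = ⊥` by `exists_mem`, hence `b ≤
aᶜ`. -/
theorem closure_basicOpen (h : IsLocalContactAlgebra ρ I) (a : B) :
    closure (basicOpen ρ I a) = (basicOpen ρ I aᶜ)ᶜ := by
  apply Set.Subset.antisymm
  · exact closure_minimal (fun F hF => F.compl_notMem hF) (isOpen_basicOpen _).isClosed_compl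
  · intro F hF
    rw [isTopologicalBasis.mem_closure_iff]
    rintro _ ⟨b, rfl⟩ hb
    have hba : b ⊓ a ≠ ⊥ := fun h0 =>
      hF (F.mem_of_le hb (le_compl_iff_disjoint_right.2 (disjoint_iff.2 h0)))
    obtain ⟨G, hG⟩ := exists_mem h hba
    exact ⟨G, G.inf_mem_iff.1 hG⟩

theorem interior_closure_basicOpen (h : IsLocalContactAlgebra ρ I) (a : B) :
    interior (closure (basicOpen ρ I a)) = basicOpen ρ I a := by
  rw [closure_basicOpen h, interior_compl, closure_basicOpen h, compl_compl, compl_compl]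

theorem closure_basicOpen_subset (h : IsLocalContactAlgebra ρ I) {a b : B}
    (hab : NonTangential ρ a b) : closure (basicOpen ρ I a) ⊆ basicOpen ρ I b := by
  rw [closure_basicOpen h]
  exact fun F hF => (F.prime a b hab).resolve_left hF

instance : T2Space (RoundPoint ρ I) := by
  have key : ∀ F G : RoundPoint ρ I, ∀ b ∈ F, b ∉ G →
      ∃ u v : Set (RoundPoint ρ I), IsOpen u ∧ IsOpen v ∧ F ∈ u ∧ G ∈ v ∧ Disjoint u v := by
    intro F G b hF hG
    obtain ⟨a, ha, hab⟩ := F.round b hF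
    exact ⟨_, _, isOpen_basicOpen a, isOpen_basicOpen aᶜ, ha, (G.prime a b hab).resolve_right hG,
      Set.disjoint_left.2 fun H hH => H.compl_notMem hH⟩
  refine ⟨fun F G hne => ?_⟩
  by_cases h1 : ∃ b ∈ F, b ∉ G
  · obtain ⟨b, hF, hG⟩ := h1
    exact key F G b hF hG
  by_cases h2 : ∃ b ∈ G, b ∉ F
  · obtain ⟨b, hG, hF⟩ := h2
    obtain ⟨u, v, hu, hv, hGu, hFv, huv⟩ := key G F b hG hF
    exact ⟨v, u, hv, hu, hFv, hGu, huv.symm⟩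
  push Not at h1 h2
  exact absurd (RoundPoint.ext (Set.Subset.antisymm h1 h2)) hne

/-- The limit of an ultrafilter of points concentrated near a bounded element. -/
def ultrafilterLim (h : IsLocalContactAlgebra ρ I) (U : Ultrafilter (RoundPoint ρ I)) {a : B}
    (haI : a ∈ I) (ha : basicOpen ρ I a ∈ U) : RoundPoint ρ I where
  carrier := {b | ∃ c, NonTangential ρ c b ∧ basicOpen ρ I c ∈ U}
  mem_of_le := by
    rintro b c ⟨d, hd, hdU⟩ hbc
    exact ⟨d, hd.mono h.1 le_rfl hbc, hdU⟩
  inf_mem := by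
    rintro b c ⟨d, hd, hdU⟩ ⟨e, he, heU⟩
    refine ⟨d ⊓ e, (hd.mono h.1 inf_le_left le_rfl).inf h.1 (he.mono h.1 inf_le_right le_rfl), ?_⟩
    filter_upwards [hdU, heU] with F hd he using F.inf_mem hd he
  bot_notMem := by
    rintro ⟨d, hd, hdU⟩
    obtain ⟨F, hF⟩ := U.nonempty_of_mem hdU
    exact F.bot_notMem (F.mem_of_le hF (hd.le h.1))
  exists_bdd := by
    obtain ⟨d, hdI, had, -⟩ := h.bc1 a haI ⊤ (.top h.1 a)
    exact ⟨d, ⟨a, had, ha⟩, hdI⟩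
  round := by
    rintro b ⟨d, hd, hdU⟩
    obtain ⟨e, -, hde, heb⟩ := h.bc1 (d ⊓ a) (I.lower inf_le_right haI) b
      (hd.mono h.1 inf_le_left le_rfl)
    refine ⟨e, ⟨d ⊓ a, hde, ?_⟩, heb⟩
    filter_upwards [hdU, ha] with F hd ha using F.inf_mem hd ha
  prime := by
    intro x y hxy
    obtain ⟨a', haI', haa', -⟩ := h.bc1 a haI ⊤ (.top h.1 a)
    -- Two interpolants `d ≪ e` are needed: the ultrafilter decides `e`, and any point missing `e`
    -- contains `dᶜ` by its own primeness.
    obtain ⟨e, heI, hxe, hey⟩ := h.bc1 (x ⊓ a') (I.lower inf_le_right haI') y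
      (hxy.mono h.1 inf_le_left le_rfl)
    obtain ⟨d, -, hxd, hde⟩ := h.bc1 (x ⊓ a') (I.lower inf_le_right haI') e hxe
    rcases U.mem_or_compl_mem (basicOpen ρ I e) with he | he
    · exact Or.inr ⟨e, hey, he⟩
    · left
      refine ⟨dᶜ ⊓ a, ?_, ?_⟩
      · have h1 : NonTangential ρ (dᶜ ⊓ a) ((x ⊓ a')ᶜ ⊓ a') :=
          ((hxd.compl h.1).mono h.1 inf_le_left le_rfl).inf h.1
            (haa'.mono h.1 inf_le_right le_rfl)
        refine h1.mono h.1 le_rfl ?_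
        rw [compl_inf, inf_sup_right, compl_inf_eq_bot, sup_bot_eq]
        exact inf_le_left
      · filter_upwards [he, ha] with F he ha
        exact F.inf_mem ((F.prime d e hde).resolve_right he) ha

theorem isCompact_closure_basicOpen (h : IsLocalContactAlgebra ρ I) {a : B} (ha : a ∈ I) :
    IsCompact (closure (basicOpen ρ I a)) := by
  obtain ⟨d, hdI, had, -⟩ := h.bc1 a ha ⊤ (.top h.1 a)
  rw [isCompact_iff_ultrafilter_le_nhds]
  intro U hU
  have hU' : closure (basicOpen ρ I a) ∈ U := Filter.le_principal_iff.1 hU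
  have hd : basicOpen ρ I d ∈ U := Filter.mem_of_superset hU' (closure_basicOpen_subset h had)
  have hle : (U : Filter _) ≤ nhds (ultrafilterLim h U hdI hd) := by
    intro s hs
    obtain ⟨_, ⟨b, rfl⟩, ⟨c, hcb, hc⟩, hbs⟩ := isTopologicalBasis.mem_nhds_iff.1 hs
    exact Filter.mem_of_superset hc (((basicOpen_subset_iff h).2 (hcb.le h.1)).trans hbs)
  exact ⟨_, isClosed_closure.mem_of_tendsto hle hU', hle⟩

/-- Bounded elements form a directed open cover, so a compact closure lies in a single one of them.
-/
theorem isCompact_closure_basicOpen_iff (h : IsLocalContactAlgebra ρ I) {a : B} :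
    IsCompact (closure (basicOpen ρ I a)) ↔ a ∈ I := by
  refine ⟨fun hc => ?_, isCompact_closure_basicOpen h⟩
  have : Nonempty {b // b ∈ I} := ⟨⟨⊥, I.bot_mem⟩⟩
  obtain ⟨⟨b, hb⟩, hsub⟩ := hc.elim_directed_cover (ι := {b // b ∈ I})
    (fun b => basicOpen ρ I b.1) (fun b => isOpen_basicOpen _) (fun F _ => by
      obtain ⟨b, hb, hbI⟩ := F.exists_bdd
      exact Set.mem_iUnion.2 ⟨⟨b, hbI⟩, hb⟩) (fun b c =>
      ⟨⟨b.1 ⊔ c.1, I.sup_mem b.2 c.2⟩, (basicOpen_subset_iff h).2 le_sup_left,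
        (basicOpen_subset_iff h).2 le_sup_right⟩)
  exact I.lower ((basicOpen_subset_iff h).1 (subset_closure.trans hsub)) hb

theorem locallyCompactSpace (h : IsLocalContactAlgebra ρ I) :
    LocallyCompactSpace (RoundPoint ρ I) := by
  have : WeaklyLocallyCompactSpace (RoundPoint ρ I) := ⟨fun F => by
    obtain ⟨a, ha, haI⟩ := F.exists_bdd
    exact ⟨_, isCompact_closure_basicOpen h haI,
      Filter.mem_of_superset ((isOpen_basicOpen a).mem_nhds ha) subset_closure⟩⟩
  infer_instance

end

/-- Completeness enters here: the join of all basic opens inside `U` has the same closure as `U`,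
and regular opens are determined by their closures. -/
theorem exists_basicOpen_eq {B : Type*} [CompleteBooleanAlgebra B] {ρ : B → B → Prop}
    {I : Order.Ideal B} (h : IsLocalContactAlgebra ρ I) {U : Set (RoundPoint ρ I)}
    (hU : interior (closure U) = U) : ∃ a, basicOpen ρ I a = U := by
  have hUo : IsOpen U := hU ▸ isOpen_interior
  let S : Set B := {b | basicOpen ρ I b ⊆ U}
  have hcl : closure U = closure (basicOpen ρ I (sSup S)) := by
    apply Set.Subset.antisymm
    · refine closure_mono fun F hF => ?_
      obtain ⟨_, ⟨b, rfl⟩, hb, hbU⟩ := isTopologicalBasis.exists_subset_of_mem_open hF hUo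
      exact F.mem_of_le hb (le_sSup hbU)
    · refine closure_minimal (fun F hF => ?_) isClosed_closure
      rw [isTopologicalBasis.mem_closure_iff]
      rintro _ ⟨b, rfl⟩ hb
      by_contra hemp
      have hdis : Disjoint b (sSup S) := by
        rw [disjoint_sSup_iff]
        intro c hc
        rw [disjoint_iff]
        by_contra h0
        obtain ⟨G, hG⟩ := exists_mem h h0
        exact hemp ⟨G, (G.inf_mem_iff.1 hG).1, hc (G.inf_mem_iff.1 hG).2⟩
      exact F.bot_notMem (hdis.eq_bot ▸ F.inf_mem hb hF)
  exact ⟨sSup S, by rw [← interior_closure_basicOpen h, ← hcl, hU]⟩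

end RoundPoint

/-! ### The local contact algebra of regular open sets -/

/-- The regular open subsets of a topological space. -/
def RegularOpens (X : Type*) [TopologicalSpace X] := Heyting.Regular (TopologicalSpace.Opens X)

/-- The regular elements of a frame form a complete Boolean algebra. -/
abbrev regularCompleteBooleanAlgebra (α : Type*) [Order.Frame α] :
    CompleteBooleanAlgebra (Heyting.Regular α) :=
  { (inferInstance : BooleanAlgebra (Heyting.Regular α)) with
    sSup := fun s => Heyting.Regular.toRegular (sSup ((↑) '' s))
    sInf := fun s => Heyting.Regular.toRegular (sInf ((↑) '' s))
    isLUB_sSup := fun s => by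
      have h := Heyting.Regular.gi.gc.isLUB_l_image (isLUB_sSup ((↑) '' s : Set α))
      rwa [Set.image_image, Set.image_congr (fun a _ => Heyting.Regular.toRegular_coe a),
        Set.image_id'] at h
    isGLB_sInf := fun s => by
      have h := Heyting.Regular.gi.isGLB_of_u_image (s := s) (isGLB_sInf _)
      exact h }

namespace RegularOpens

instance {X : Type*} [TopologicalSpace X] : CompleteBooleanAlgebra (RegularOpens X) :=
  regularCompleteBooleanAlgebra (TopologicalSpace.Opens X)

section

variable {X : Type*} [TopologicalSpace X]

/-- The underlying set of a regular open. -/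
def pts (U : RegularOpens X) : Set X := (U : Heyting.Regular (TopologicalSpace.Opens X)).val

theorem isOpen_pts (U : RegularOpens X) : IsOpen (pts U) :=
  (U : Heyting.Regular (TopologicalSpace.Opens X)).val.isOpen

theorem pts_subset_pts {U V : RegularOpens X} : pts U ⊆ pts V ↔ U ≤ V := Iff.rfl

theorem pts_injective : Function.Injective (pts : RegularOpens X → Set X) := fun _ _ h =>
  le_antisymm (pts_subset_pts.1 h.subset) (pts_subset_pts.1 h.symm.subset)

theorem pts_inf (U V : RegularOpens X) : pts (U ⊓ V) = pts U ∩ pts V := rfl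

@[simp]
theorem pts_bot : pts (⊥ : RegularOpens X) = ∅ := rfl

theorem pts_compl (U : RegularOpens X) : pts Uᶜ = (closure (pts U))ᶜ := by
  rw [← interior_compl]
  exact TopologicalSpace.Opens.coe_compl_eq_interior_compl

/-- The interior of the closure of a set, as a regular open. -/
def reg (s : Set X) : RegularOpens X :=
  Heyting.Regular.toRegular ⟨interior (closure s), isOpen_interior⟩

theorem pts_reg (s : Set X) : pts (reg s) = interior (closure s) := by
  change ((⟨interior (closure s), isOpen_interior⟩ᶜᶜ : TopologicalSpace.Opens X) : Set X) = _
  simp only [TopologicalSpace.Opens.coe_compl_eq_interior_compl, TopologicalSpace.Opens.coe_mk,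
    interior_compl, compl_compl]
  exact interior_closure_idem

theorem interior_closure_pts (U : RegularOpens X) : interior (closure (pts U)) = pts U := by
  rw [← compl_compl (closure (pts U)), ← pts_compl, interior_compl, ← pts_compl, compl_compl]

theorem reg_pts (U : RegularOpens X) : reg (pts U) = U :=
  pts_injective ((pts_reg _).trans (interior_closure_pts U))

theorem subset_pts_reg {s : Set X} (hs : IsOpen s) : s ⊆ pts (reg s) := by
  rw [pts_reg]
  exact hs.subset_interior_closure

theorem reg_le_iff {s : Set X} (hs : IsOpen s) {U : RegularOpens X} :
    reg s ≤ U ↔ s ⊆ pts U := by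
  refine ⟨fun h => (subset_pts_reg hs).trans h, fun h => ?_⟩
  rw [← pts_subset_pts, pts_reg, ← interior_closure_pts U]
  exact interior_mono (closure_mono h)

theorem closure_pts_reg {s : Set X} (hs : IsOpen s) : closure (pts (reg s)) = closure s := by
  refine Set.Subset.antisymm ?_ (closure_mono (subset_pts_reg hs))
  rw [pts_reg]
  exact closure_minimal interior_subset isClosed_closure

theorem closure_pts_sup (U V : RegularOpens X) :
    closure (pts (U ⊔ V)) = closure (pts U) ∪ closure (pts V) := by
  rw [← compl_inj_iff, ← pts_compl, compl_sup, pts_inf, pts_compl, pts_compl, Set.compl_union]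

theorem ne_bot_iff {U : RegularOpens X} : U ≠ ⊥ ↔ (pts U).Nonempty := by
  rw [Set.nonempty_iff_ne_empty, ← pts_bot, pts_injective.ne_iff]

theorem disjoint_iff_pts {U V : RegularOpens X} : Disjoint U V ↔ Disjoint (pts U) (pts V) := by
  rw [disjoint_iff, Set.disjoint_iff_inter_eq_empty, ← pts_inf, ← pts_bot, pts_injective.eq_iff]

/-- Two regular opens are in contact when their closures meet. -/
def Contact (U V : RegularOpens X) : Prop := (closure (pts U) ∩ closure (pts V)).Nonempty

theorem nonTangential_iff {U V : RegularOpens X} :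
    NonTangential Contact U V ↔ closure (pts U) ⊆ pts V := by
  rw [NonTangential, Contact, Set.not_nonempty_iff_eq_empty, ← Set.disjoint_iff_inter_eq_empty,
    ← Set.subset_compl_iff_disjoint_right, ← pts_compl, compl_compl]

/-- The ideal of regular opens with compact closure. -/
def bounded (X : Type*) [TopologicalSpace X] : Order.Ideal (RegularOpens X) :=
  Order.IsIdeal.toIdeal (I := {U | IsCompact (closure (pts U))})
    { IsLowerSet := fun _ _ hle hU => IsCompact.of_isClosed_subset hU isClosed_closure
        (closure_mono (pts_subset_pts.2 hle))
      Nonempty := ⟨⊥, by simp⟩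
      Directed := fun U hU V hV => ⟨U ⊔ V, by
        rw [Set.mem_ofPred_eq, closure_pts_sup]
        exact IsCompact.union hU hV, le_sup_left, le_sup_right⟩ }

theorem mem_bounded {U : RegularOpens X} : U ∈ bounded X ↔ IsCompact (closure (pts U)) := Iff.rfl

theorem exists_between [LocallyCompactSpace X] [T2Space X] {K U : Set X} (hK : IsCompact K)
    (hU : IsOpen U) (hKU : K ⊆ U) :
    ∃ V ∈ bounded X, K ⊆ pts V ∧ closure (pts V) ⊆ U := by
  obtain ⟨V, hV, hKV, hVU, hVc⟩ := exists_open_between_and_isCompact_closure hK hU hKU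
  refine ⟨reg V, ?_, hKV.trans (subset_pts_reg hV), ?_⟩
  · rwa [mem_bounded, closure_pts_reg hV]
  · rwa [closure_pts_reg hV]

theorem exists_mem_subset [LocallyCompactSpace X] [T2Space X] {x : X} {U : Set X}
    (hU : IsOpen U) (hx : x ∈ U) : ∃ V ∈ bounded X, x ∈ pts V ∧ closure (pts V) ⊆ U := by
  obtain ⟨V, hV, hxV, hVU⟩ := exists_between isCompact_singleton hU (Set.singleton_subset_iff.2 hx)
  exact ⟨V, hV, hxV rfl, hVU⟩

theorem isLocalContactAlgebra (X : Type*) [TopologicalSpace X] [LocallyCompactSpace X]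
    [T2Space X] : IsLocalContactAlgebra (Contact (X := X)) (bounded X) where
  c1 U hU := by simpa [Contact] using ne_bot_iff.1 hU
  c2 U V hUV := ⟨ne_bot_iff.2 (closure_nonempty_iff.1 hUV.left),
    ne_bot_iff.2 (closure_nonempty_iff.1 hUV.right)⟩
  c3 U V hUV := by rwa [Contact, Set.inter_comm]
  c4 U V W := by
    rw [Contact, closure_pts_sup, Set.inter_union_distrib_left, Set.union_nonempty]
    rfl
  bc1 U hU W hUW := by
    rw [nonTangential_iff] at hUW
    obtain ⟨V, hV, hUV, hVW⟩ := exists_between hU (isOpen_pts W) hUW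
    exact ⟨V, hV, nonTangential_iff.2 hUV, nonTangential_iff.2 hVW⟩
  bc2 U V hUV := by
    obtain ⟨x, hxU, hxV⟩ := hUV
    obtain ⟨W, hW, hxW, -⟩ := exists_mem_subset isOpen_univ (Set.mem_univ x)
    refine ⟨W, hW, x, hxU, ?_⟩
    rw [pts_inf]
    exact (isOpen_pts W).inter_closure ⟨hxW, hxV⟩
  bc3 U hU := by
    obtain ⟨x, hx⟩ := ne_bot_iff.1 hU
    obtain ⟨V, hV, hxV, hVU⟩ := exists_mem_subset (isOpen_pts U) hx
    exact ⟨V, hV, ne_bot_iff.2 ⟨x, hxV⟩, nonTangential_iff.2 hVU⟩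

/-- Every point of the algebra of regular opens is given by a point of the space. -/
theorem exists_forall_mem_iff [LocallyCompactSpace X] [T2Space X]
    (F : RoundPoint (Contact (X := X)) (bounded X)) : ∃ x, ∀ U, U ∈ F ↔ x ∈ pts U := by
  obtain ⟨K, hKF, hK⟩ := F.exists_bdd
  have hne : Nonempty {U // U ∈ F} := ⟨⟨K, hKF⟩⟩
  -- Meeting each member with the bounded `K` makes the closures compact, so they have a common
  -- point.
  obtain ⟨x, hx⟩ := IsCompact.nonempty_iInter_of_directed_nonempty_isCompact_isClosed
    (fun U : {U // U ∈ F} => closure (pts (U.1 ⊓ K)))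
    (fun U V => ⟨⟨U.1 ⊓ V.1, F.inf_mem U.2 V.2⟩,
      closure_mono (pts_subset_pts.2 (inf_le_inf_right K inf_le_left)),
      closure_mono (pts_subset_pts.2 (inf_le_inf_right K inf_le_right))⟩)
    (fun U => (ne_bot_iff.1 fun h => F.bot_notMem (h ▸ F.inf_mem U.2 hKF)).closure)
    (fun U => (bounded X).lower inf_le_right hK) (fun U => isClosed_closure)
  have hxF : ∀ U ∈ F, x ∈ closure (pts U) := fun U hU =>
    closure_mono (pts_subset_pts.2 inf_le_left) (Set.mem_iInter.1 hx ⟨U, hU⟩)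
  refine ⟨x, fun U => ⟨fun hU => ?_, fun hU => ?_⟩⟩
  · obtain ⟨V, hV, hVU⟩ := F.round U hU
    exact nonTangential_iff.1 hVU (hxF V hV)
  · obtain ⟨V, -, hxV, hVU⟩ := exists_mem_subset (isOpen_pts U) hU
    refine (F.prime V U (nonTangential_iff.2 hVU)).resolve_left fun hV => ?_
    have h := hxF _ hV
    rw [pts_compl, closure_compl] at h
    exact h (subset_interior_iff_isOpen.2 (isOpen_pts V) |>.trans (interior_mono subset_closure) hxV)

/-- The point of the algebra of regular opens given by a point of the space. -/
def toRoundPoint [LocallyCompactSpace X] [T2Space X] (x : X) :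
    RoundPoint (Contact (X := X)) (bounded X) where
  carrier := {U | x ∈ pts U}
  mem_of_le h hle := pts_subset_pts.2 hle h
  inf_mem hU hV := ⟨hU, hV⟩
  bot_notMem h := h
  exists_bdd := by
    obtain ⟨V, hV, hxV, -⟩ := exists_mem_subset isOpen_univ (Set.mem_univ x)
    exact ⟨V, hxV, hV⟩
  round U hU := by
    obtain ⟨V, hV, hxV, hVU⟩ := exists_mem_subset (isOpen_pts U) hU
    exact ⟨V, hxV, nonTangential_iff.2 hVU⟩
  prime U V hUV := by
    by_cases hx : x ∈ closure (pts U)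
    · exact Or.inr (nonTangential_iff.1 hUV hx)
    · left
      rwa [Set.mem_ofPred_eq, pts_compl]

theorem eq_of_forall_mem_pts_iff [LocallyCompactSpace X] [T2Space X] {x y : X}
    (h : ∀ U : RegularOpens X, x ∈ pts U ↔ y ∈ pts U) : x = y := by
  by_contra hne
  obtain ⟨U, -, hxU, hU⟩ := exists_mem_subset (isOpen_compl_singleton (x := y)) hne
  exact hU (subset_closure ((h U).1 hxU)) rfl

end

/-! ### Images and preimages of regular open sets -/

section

variable {X Y : Type*} [TopologicalSpace X] [TopologicalSpace Y]

/-- Preimage under a continuous open map commutes with both closure and interior, so regularization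
changes nothing. -/
theorem pts_reg_preimage {f : X → Y} (hf : Continuous f) (hfo : IsOpenMap f)
    (V : RegularOpens Y) : pts (reg (f ⁻¹' pts V)) = f ⁻¹' pts V := by
  rw [pts_reg, ← hfo.preimage_closure_eq_closure_preimage hf,
    ← hfo.preimage_interior_eq_interior_preimage hf, interior_closure_pts]

theorem gc_reg_image {f : X → Y} (hf : Continuous f) (hfo : IsOpenMap f) :
    GaloisConnection (fun U : RegularOpens X => reg (f '' pts U))
      (fun V : RegularOpens Y => reg (f ⁻¹' pts V)) := by
  intro U V
  rw [reg_le_iff (hfo _ (isOpen_pts U)), Set.image_subset_iff, ← pts_reg_preimage hf hfo]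
  rfl

end

end RegularOpens

theorem rightAdjoint_eq_of_gc {A B : Type*} [CompleteBooleanAlgebra A]
    [CompleteBooleanAlgebra B] {ψ : A → B} {φ : B → A} (h : GaloisConnection ψ φ) :
    rightAdjoint ψ = φ := by
  funext b
  exact le_antisymm (sSup_le fun a ha => h.le_u ha) (le_sSup (h.l_u_le b))

namespace RegularOpens

/-- Closedness makes image commute with closure, giving (EL4), (EL5) and the lifting of a contact
point in (EL7). Openness does the same for preimage, and properness gives (EL6). -/
theorem isEOpPerLCHom_reg_image {X Y : Type*} [TopologicalSpace X] [TopologicalSpace Y]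
    [LocallyCompactSpace X] [T2Space X]
    {f : X → Y} (hf : IsPerfectMap f) (hfo : IsOpenMap f) :
    IsEOpPerLCHom Contact (bounded X) Contact (bounded Y)
      (fun U : RegularOpens X => reg (f '' pts U)) := by
  have gc := gc_reg_image hf.continuous hfo
  have hadj := rightAdjoint_eq_of_gc gc
  have hcl : ∀ U : RegularOpens X, closure (pts (reg (f '' pts U))) = f '' closure (pts U) := by
    intro U
    rw [closure_pts_reg (hfo _ (isOpen_pts U)),
      hf.isClosedMap.closure_image_eq_of_continuous hf.continuous]
  have hpre : ∀ V : RegularOpens Y,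
      closure (pts (reg (f ⁻¹' pts V))) = f ⁻¹' closure (pts V) := by
    intro V
    rw [pts_reg_preimage hf.continuous hfo,
      hfo.preimage_closure_eq_closure_preimage hf.continuous]
  exact
  { ef1 := fun U => by
      rw [← le_bot_iff, reg_le_iff (hfo _ (isOpen_pts U)), pts_bot, Set.subset_empty_iff,
        Set.image_eq_empty, ← pts_bot, pts_injective.eq_iff]
    ef2 := fun s => by rw [gc.l_sSup, sSup_image]
    ef3 := fun U W hW => by
      -- The image of this witness is `f '' pts U ∩ pts W`, which is dense in `pts W` because `pts
      -- W` lies in the closure of `f '' pts U`.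
      refine ⟨U ⊓ reg (f ⁻¹' pts W), inf_le_left, ?_⟩
      rw [pts_inf, pts_reg_preimage hf.continuous hfo, Set.image_inter_preimage]
      apply le_antisymm
      · rw [reg_le_iff ((hfo _ (isOpen_pts U)).inter (isOpen_pts W))]
        exact Set.inter_subset_right
      · rw [← pts_subset_pts, pts_reg]
        refine (isOpen_pts W).subset_interior_iff.2 fun y hy => ?_
        rw [Set.inter_comm]
        refine (isOpen_pts W).inter_closure ⟨hy, ?_⟩
        have := pts_subset_pts.2 hW hy
        rw [pts_reg] at this
        exact interior_subset this
    el4 := fun U V ⟨x, hxU, hxV⟩ => ⟨f x, by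
      rw [hcl]; exact Set.mem_image_of_mem f hxU, by
      rw [hcl]; exact Set.mem_image_of_mem f hxV⟩
    el5 := fun U hU => by
      rw [mem_bounded, hcl]
      exact IsCompact.image hU hf.continuous
    el6 := fun V hV => by
      rw [hadj, mem_bounded, hpre]
      exact (isProperMap_iff_isClosedMap_and_compact_fibers.2
        ⟨hf.continuous, hf.isClosedMap, hf.isCompact_fiber⟩).isCompact_preimage hV
    el7 := fun V U hU ⟨y, hyU, hyV⟩ => by
      rw [hcl] at hyU
      obtain ⟨x, hx, rfl⟩ := hyU
      rw [hadj]
      exact ⟨x, hx, by rw [hpre]; exact hyV⟩ }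

end RegularOpens

/-! ### The action of morphisms on points -/

section Comap

variable {A B : Type*} [CompleteBooleanAlgebra A] [CompleteBooleanAlgebra B]
  {ρ : A → A → Prop} {I : Order.Ideal A} {η : B → B → Prop} {J : Order.Ideal B} {ψ : A → B}

namespace IsESkeLCHom

theorem gc (hψ : IsESkeLCHom ρ I η J ψ) : GaloisConnection ψ (rightAdjoint ψ) :=
  gc_rightAdjoint hψ.ef2

/-- (EF3) lifts `ψ a ⊓ b` to an element below both `a` and `rightAdjoint ψ b`; (EF1) transfers being
zero in either direction. -/
theorem disjoint_rightAdjoint_iff (hψ : IsESkeLCHom ρ I η J ψ) {a : A} {b : B} :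
    Disjoint a (rightAdjoint ψ b) ↔ Disjoint (ψ a) b := by
  refine ⟨fun h => disjoint_iff.2 ?_, fun h => disjoint_iff.2 ?_⟩
  · obtain ⟨c, hca, hc⟩ := hψ.ef3 a (ψ a ⊓ b) inf_le_left
    have hcb : c ≤ rightAdjoint ψ b := (hψ.gc c b).1 (hc.trans_le inf_le_right)
    rw [← hc, hψ.ef1]
    exact le_bot_iff.1 (h hca hcb)
  · rw [← hψ.ef1]
    exact le_bot_iff.1 (h (hψ.gc.monotone_l inf_le_left)
      ((hψ.gc.monotone_l inf_le_right).trans (hψ.gc.l_u_le b)))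

theorem rightAdjoint_compl (hψ : IsESkeLCHom ρ I η J ψ) (b : B) :
    rightAdjoint ψ bᶜ = (rightAdjoint ψ b)ᶜ :=
  eq_of_forall_le_iff fun a => by
    rw [← hψ.gc a, le_compl_iff_disjoint_right, le_compl_iff_disjoint_right,
      hψ.disjoint_rightAdjoint_iff]

theorem nonTangential_rightAdjoint (hψ : IsESkeLCHom ρ I η J ψ) (hη : IsContactRelation η)
    {b c : B} (h : NonTangential η b c) :
    NonTangential ρ (rightAdjoint ψ b) (rightAdjoint ψ c) := fun hρ => by
  rw [← hψ.rightAdjoint_compl] at hρ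
  exact h (hη.mono (hψ.el4 _ _ hρ) (hψ.gc.l_u_le b) (hψ.gc.l_u_le cᶜ))

end IsESkeLCHom

/-- The map on points induced by an `EOpPerLC`-morphism. -/
def RoundPoint.map (hψ : IsEOpPerLCHom ρ I η J ψ) (hρ : IsLocalContactAlgebra ρ I)
    (hη : IsContactRelation η) (F : RoundPoint ρ I) : RoundPoint η J where
  carrier := {b | rightAdjoint ψ b ∈ F}
  mem_of_le h hle := F.mem_of_le h (hψ.gc.monotone_u hle)
  inf_mem hb hc := by
    rw [Set.mem_ofPred_eq, hψ.gc.u_inf]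
    exact F.inf_mem hb hc
  bot_notMem h := by
    have h0 : rightAdjoint ψ ⊥ = ⊥ := (hψ.ef1 _).1 (le_bot_iff.1 (hψ.gc.l_u_le ⊥))
    rw [Set.mem_ofPred_eq, h0] at h
    exact F.bot_notMem h
  exists_bdd := by
    obtain ⟨a, ha, haI⟩ := F.exists_bdd
    exact ⟨ψ a, F.mem_of_le ha (hψ.gc.le_u_l a), hψ.el5 a haI⟩
  round b hb := by
    -- The smaller element must be bounded, since (EL7) applies only to bounded elements.
    obtain ⟨a, ha, haI, hab⟩ := F.exists_bdd_nonTangential hρ hb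
    refine ⟨ψ a, F.mem_of_le ha (hψ.gc.le_u_l a), fun h => hab ?_⟩
    rw [← hψ.rightAdjoint_compl]
    exact hψ.el7 _ a haI h
  prime b c hbc := by
    rw [Set.mem_ofPred_eq, Set.mem_ofPred_eq, hψ.rightAdjoint_compl]
    exact F.prime _ _ (hψ.nonTangential_rightAdjoint hη hbc)

/-- Order isomorphisms preserving contact and boundedness are `EOpPerLC`-morphisms. -/
theorem isEOpPerLCHom_of_orderIso (e : A ≃o B) (hρ : ∀ a b, η (e a) (e b) ↔ ρ a b)
    (hI : ∀ a, e a ∈ J ↔ a ∈ I) : IsEOpPerLCHom ρ I η J e := by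
  have hadj : rightAdjoint e = e.symm := rightAdjoint_eq_of_gc e.to_galoisConnection
  exact
  { ef1 := fun a => map_eq_bot_iff e
    ef2 := fun s => by rw [e.map_sSup, sSup_image]
    ef3 := fun a b h => ⟨e.symm b, by rwa [e.symm_apply_le], e.apply_symm_apply b⟩
    el4 := fun a b => (hρ a b).2
    el5 := fun a => (hI a).2
    el6 := fun b hb => by
      rw [hadj, ← hI, e.apply_symm_apply]
      exact hb
    el7 := fun b a _ h => by
      rw [hadj, ← hρ, e.apply_symm_apply]
      exact h }

end Comap

/-! ### Faithfulness and fullness for spaces -/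

namespace RegularOpens

/-- Equal left adjoints have equal right adjoints, namely preimages, and regular opens separate the
points of `Y`. -/
theorem eq_of_reg_image_eq {X Y : Type*} [TopologicalSpace X] [TopologicalSpace Y]
    [LocallyCompactSpace Y] [T2Space Y] {f g : X → Y} (hf : Continuous f) (hfo : IsOpenMap f)
    (hg : Continuous g) (hgo : IsOpenMap g)
    (h : ∀ U : RegularOpens X, reg (f '' pts U) = reg (g '' pts U)) : f = g := by
  have hadj : (fun V : RegularOpens Y => reg (f ⁻¹' pts V)) = fun V => reg (g ⁻¹' pts V) := by
    rw [← rightAdjoint_eq_of_gc (gc_reg_image hf hfo),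
      ← rightAdjoint_eq_of_gc (gc_reg_image hg hgo), funext h]
  funext x
  refine eq_of_forall_mem_pts_iff fun V => ?_
  change x ∈ f ⁻¹' pts V ↔ x ∈ g ⁻¹' pts V
  rw [← pts_reg_preimage hf hfo, ← pts_reg_preimage hg hgo, congrFun hadj V]

variable {X Y : Type*} [TopologicalSpace X] [TopologicalSpace Y] [LocallyCompactSpace X]
  [T2Space X] [LocallyCompactSpace Y] [T2Space Y]

/-- Every `EOpPerLC`-morphism between regular open algebras is induced by an open perfect map. -/
theorem exists_map_of_isEOpPerLCHom {ψ : RegularOpens X → RegularOpens Y}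
    (hψ : IsEOpPerLCHom Contact (bounded X) Contact (bounded Y) ψ) :
    ∃ f : X → Y, IsPerfectMap f ∧ IsOpenMap f ∧ ∀ U, reg (f '' pts U) = ψ U := by
  have hpt : ∀ x : X, ∃ y : Y, ∀ V, x ∈ pts (rightAdjoint ψ V) ↔ y ∈ pts V := fun x =>
    exists_forall_mem_iff (RoundPoint.map hψ (isLocalContactAlgebra X)
      (isLocalContactAlgebra Y).1 (toRoundPoint x))
  choose f hf using hpt
  have hpre : ∀ V, f ⁻¹' pts V = pts (rightAdjoint ψ V) := fun V => Set.ext fun x => (hf x V).symm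
  have hcont : Continuous f := by
    refine continuous_def.2 fun W hW => isOpen_iff_forall_mem_open.2 fun x hx => ?_
    obtain ⟨V, -, hV, hVW⟩ := exists_mem_subset hW hx
    exact ⟨f ⁻¹' pts V, Set.preimage_mono (subset_closure.trans hVW),
      hpre V ▸ isOpen_pts _, hV⟩
  -- A compact set sits inside a bounded `V`, whose preimage is relatively compact by (EL6).
  have hproper : IsProperMap f := by
    refine isProperMap_iff_isCompact_preimage.2 ⟨hcont, fun K hK => ?_⟩
    obtain ⟨V, hV, hKV, -⟩ := exists_between hK isOpen_univ (Set.subset_univ K)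
    refine IsCompact.of_isClosed_subset (hψ.el6 V hV) (hK.isClosed.preimage hcont) ?_
    exact (Set.preimage_mono hKV).trans ((hpre V).subset.trans subset_closure)
  -- This yields openness: `f x` lies in the open set `pts (ψ U)` for each `U` containing `x`, and
  -- `closure (pts U)` can be chosen inside any given neighbourhood of `x`.
  have hsub : ∀ U ∈ bounded X, pts (ψ U) ⊆ f '' closure (pts U) := by
    intro U hU y hy
    by_contra hyU
    obtain ⟨V, -, hyV, hV⟩ := exists_mem_subset (IsCompact.image hU hcont).isClosed.isOpen_compl hyU
    have hdis : Disjoint U (rightAdjoint ψ V) := by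
      rw [disjoint_iff_pts, ← hpre, Set.disjoint_left]
      exact fun x hx hxV => hV (subset_closure hxV) ⟨x, subset_closure hx, rfl⟩
    exact Set.disjoint_left.1 (disjoint_iff_pts.1 (hψ.disjoint_rightAdjoint_iff.1 hdis)) hy hyV
  have hopen : IsOpenMap f := by
    intro W hW
    refine isOpen_iff_forall_mem_open.2 ?_
    rintro _ ⟨x, hx, rfl⟩
    obtain ⟨U, hU, hxU, hUW⟩ := exists_mem_subset hW hx
    exact ⟨pts (ψ U), (hsub U hU).trans (Set.image_mono hUW), isOpen_pts _,
      (hf x _).1 (pts_subset_pts.2 (hψ.gc.le_u_l U) hxU)⟩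
  refine ⟨f, ⟨hcont, hproper.isClosedMap, fun y => hproper.isCompact_preimage isCompact_singleton⟩,
    hopen, fun U => ?_⟩
  refine eq_of_forall_ge_iff fun V => ?_
  rw [reg_le_iff (hopen _ (isOpen_pts U)), Set.image_subset_iff, hpre, hψ.gc]
  rfl

end RegularOpens

/-! ### Representation of algebras and the equivalence -/

/-- A local contact algebra is isomorphic to the regular open algebra of its space of points. -/
noncomputable def RoundPoint.orderIso {B : Type*} [CompleteBooleanAlgebra B] {ρ : B → B → Prop}
    {I : Order.Ideal B} (h : IsLocalContactAlgebra ρ I) : B ≃o RegularOpens (RoundPoint ρ I) :=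
  have pts_reg_basicOpen : ∀ a, RegularOpens.pts (RegularOpens.reg (basicOpen ρ I a)) =
      basicOpen ρ I a := fun a => by
    rw [RegularOpens.pts_reg, interior_closure_basicOpen h]
  have map_le : ∀ a b, RegularOpens.reg (basicOpen ρ I a) ≤ RegularOpens.reg (basicOpen ρ I b) ↔
      a ≤ b := fun a b => by
    rw [RegularOpens.reg_le_iff (isOpen_basicOpen a), pts_reg_basicOpen, basicOpen_subset_iff h]
  RelIso.ofSurjective (OrderEmbedding.ofMapLEIff _ map_le) fun U => by
    obtain ⟨a, ha⟩ := exists_basicOpen_eq h (RegularOpens.interior_closure_pts U)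
    exact ⟨a, RegularOpens.pts_injective ((pts_reg_basicOpen a).trans ha)⟩

theorem RoundPoint.pts_orderIso {B : Type*} [CompleteBooleanAlgebra B] {ρ : B → B → Prop}
    {I : Order.Ideal B} (h : IsLocalContactAlgebra ρ I) (a : B) :
    RegularOpens.pts (orderIso h a) = basicOpen ρ I a := by
  change RegularOpens.pts (RegularOpens.reg (basicOpen ρ I a)) = _
  rw [RegularOpens.pts_reg, interior_closure_basicOpen h]

theorem RoundPoint.contact_orderIso_iff {B : Type*} [CompleteBooleanAlgebra B]
    {ρ : B → B → Prop} {I : Order.Ideal B} (h : IsLocalContactAlgebra ρ I) (a b : B) :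
    RegularOpens.Contact (orderIso h a) (orderIso h b) ↔ ρ a b := by
  rw [RegularOpens.Contact, pts_orderIso, pts_orderIso, closure_basicOpen h, closure_basicOpen h]
  exact ⟨fun ⟨F, ha, hb⟩ => F.rel_of_compl_notMem ha hb, fun hab => exists_of_rel h hab⟩

theorem RoundPoint.orderIso_mem_bounded_iff {B : Type*} [CompleteBooleanAlgebra B]
    {ρ : B → B → Prop} {I : Order.Ideal B} (h : IsLocalContactAlgebra ρ I) (a : B) :
    orderIso h a ∈ RegularOpens.bounded (RoundPoint ρ I) ↔ a ∈ I := by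
  rw [RegularOpens.mem_bounded, pts_orderIso, isCompact_closure_basicOpen_iff h]

open RegularOpens in
/-- The functor sending a space to its local contact algebra of regular open sets. -/
def regularOpensFunctor : OpPerLC.{u} ⥤ EOpPerLC.{u} where
  obj X :=
    { carrier := RegularOpens X.carrier
      rel := Contact
      bdd := bounded X.carrier
      isLocalContactAlgebra := isLocalContactAlgebra X.carrier }
  map f := ⟨fun U => reg (f.toFun '' pts U), isEOpPerLCHom_reg_image f.isPerfectMap f.isOpenMap⟩
  map_id X := EOpPerLC.Hom.ext (funext fun U => by
    change reg ((fun x => x) '' pts U) = U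
    rw [Set.image_id', reg_pts])
  map_comp f g := EOpPerLC.Hom.ext (funext fun U => by
    change reg ((fun x => g.toFun (f.toFun x)) '' pts U) =
      reg (g.toFun '' pts (reg (f.toFun '' pts U)))
    have hfU := f.isOpenMap _ (isOpen_pts U)
    -- Both sides have the same regular open upper bounds `V`, by adjunction with preimage; this
    -- avoids handling nested regularizations.
    refine eq_of_forall_ge_iff fun V => ?_
    rw [reg_le_iff (g.isOpenMap _ (isOpen_pts _)), Set.image_subset_iff,
      ← pts_reg_preimage g.isPerfectMap.continuous g.isOpenMap, pts_subset_pts, reg_le_iff hfU,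
      pts_reg_preimage g.isPerfectMap.continuous g.isOpenMap, ← Set.image_subset_iff,
      Set.image_image, reg_le_iff]
    rw [← Set.image_image g.toFun f.toFun]
    exact g.isOpenMap _ hfU)

instance : regularOpensFunctor.{u}.Faithful where
  map_injective {_ _} f g h := OpPerLC.Hom.ext
    (RegularOpens.eq_of_reg_image_eq f.isPerfectMap.continuous f.isOpenMap
      g.isPerfectMap.continuous g.isOpenMap fun U => congrFun (congrArg EOpPerLC.Hom.toFun h) U)

instance : regularOpensFunctor.{u}.Full where
  map_surjective {_ _} ψ := by
    obtain ⟨f, hf, hfo, h⟩ := RegularOpens.exists_map_of_isEOpPerLCHom ψ.isHom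
    exact ⟨⟨f, hf, hfo⟩, EOpPerLC.Hom.ext (funext h)⟩

instance : regularOpensFunctor.{u}.EssSurj where
  mem_essImage B := by
    have h := B.isLocalContactAlgebra
    have := RoundPoint.locallyCompactSpace h
    let e := RoundPoint.orderIso h
    refine ⟨⟨RoundPoint B.rel B.bdd⟩, ⟨Iso.symm ⟨⟨e, ?_⟩, ⟨e.symm, ?_⟩, ?_, ?_⟩⟩⟩
    · exact isEOpPerLCHom_of_orderIso e (RoundPoint.contact_orderIso_iff h)
        (RoundPoint.orderIso_mem_bounded_iff h)
    · refine isEOpPerLCHom_of_orderIso e.symm (fun U V => ?_) (fun U => ?_)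
      · rw [← RoundPoint.contact_orderIso_iff h, e.apply_symm_apply, e.apply_symm_apply]
        rfl
      · rw [← RoundPoint.orderIso_mem_bounded_iff h, e.apply_symm_apply]
        rfl
    · exact EOpPerLC.Hom.ext (funext e.symm_apply_apply)
    · exact EOpPerLC.Hom.ext (funext e.apply_symm_apply)

instance : regularOpensFunctor.{u}.IsEquivalence where

end LocalContact

theorem theorem4p11 :
    Nonempty (LocalContact.OpPerLC.{u} ≌ LocalContact.EOpPerLC.{u}) :=
  ⟨LocalContact.regularOpensFunctor.asEquivalence⟩
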